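/- All trees are finite. A \emph{subtree} of a tree $T$ is a nonempty subgraph of $T$ that is itself a tree. For a vertex $v$ of $T$, let $p(T,v)=N(T,v)/N(T)$, where $N(T)$ is the number of subtrees of $T$ and $N(T,v)$ is the number of subtrees of $T$ that contain $v$; that is, $p(T,v)$ is the probability that a uniformly random subtree of $T$ contains $v$. A tree is \emph{series-reduced} if it has no vertex of degree $2$, and a \emph{leaf} is a vertex of degree $1$. 1. As $T$ ranges over all trees and $v$ over all vertices of $T$, the values $p(T,v)$ are dense in $[0,1]$. 2. Let $T$ be a series-reduced tree with more than $2$ vertices and let $v$ be a vertex of $T$. If $v$ is a leaf, then $p(T,v)\in[\frac13,\frac12]$; otherwise $p(T,v)\in[\frac23,1]$. 3. As $T$ ranges over all series-reduced trees with more than $2$ vertices, the values $p(T,v)$ for leaves $v$ of $T$ are dense in $[\frac13,\frac12]$, and the values $p(T,v)$ for vertices $v$ of $T$ that are not leaves are dense in $[\frac23,1]$. -/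

import Mathlib

/-- The set of subtrees of `T`: the subgraphs of `T` that are themselves trees
(trees are nonempty, since connected graphs are nonempty in Mathlib). -/
def subtrees {V : Type*} (T : SimpleGraph V) : Set T.Subgraph :=
  {S | S.coe.IsTree}

/-- The set of subtrees of `T` that contain the vertex `v`. -/
def subtreesAt {V : Type*} (T : SimpleGraph V) (v : V) : Set T.Subgraph :=
  {S | S ∈ subtrees T ∧ v ∈ S.verts}

/-- The probability that a uniformly random subtree of the (finite) tree `T` contains `v`. -/
noncomputable def subtreeProb {V : Type*} (T : SimpleGraph V) (v : V) : ℝ :=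
  ((subtreesAt T v).ncard : ℝ) / ((subtrees T).ncard : ℝ)

/-- No vertex of `T` has degree 2. -/
def IsSeriesReduced {V : Type*} (T : SimpleGraph V) : Prop :=
  ∀ v, (T.neighborSet v).ncard ≠ 2

/-- The vertex `v` has degree 1. -/
def IsLeafOf {V : Type*} (T : SimpleGraph V) (v : V) : Prop :=
  (T.neighborSet v).ncard = 1

/-- All values of `subtreeProb T v` for a finite tree `T` and a vertex `v`. -/
def treeValues : Set ℝ :=
  {p | ∃ (V : Type) (_ : Finite V) (T : SimpleGraph V) (v : V),
    T.IsTree ∧ p = subtreeProb T v}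

/-- All values of `subtreeProb T v` for a finite series-reduced tree `T` with more than two
vertices and a leaf `v` of `T`. -/
def leafValues : Set ℝ :=
  {p | ∃ (V : Type) (_ : Finite V) (T : SimpleGraph V) (v : V),
    T.IsTree ∧ IsSeriesReduced T ∧ 2 < Nat.card V ∧ IsLeafOf T v ∧ p = subtreeProb T v}

/-- All values of `subtreeProb T v` for a finite series-reduced tree `T` with more than two
vertices and a vertex `v` of `T` that is not a leaf. -/
def internalValues : Set ℝ :=
  {p | ∃ (V : Type) (_ : Finite V) (T : SimpleGraph V) (v : V),
    T.IsTree ∧ IsSeriesReduced T ∧ 2 < Nat.card V ∧ ¬ IsLeafOf T v ∧ p = subtreeProb T v}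

/-! Root the tree at `v` and let a and b count the subtrees containing and avoiding `v`, so that p =
1/(1 + b/a). Joining a second rooted tree with counts a', b' to the root by an edge gives the counts
a(1 + a') and b + a' + b' (`countOn_graft`, `countOff_graft`), and every finite rooted tree arises
in this way from single vertices (`isTree_induction`). The ranges follow by induction from
inequalities that depend on the degree of the root (`RootedBounds.graft`). Degree 2 is excluded only
away from the root, because the root passes through all smaller degrees during the construction.

For density, take a new root with k leaves and one branch of ratio x = b/a. Its ratio tends to (1 +
x)/2^k as a grows (`Approx.extend`). For k ≥ 1 these maps send [0,1] into itself, contract by at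
least 1/2, and together cover (0,1]; stars have ratio k/2^k → 0. Hence the ratios are dense in
[0,1]. One last step with k ≥ 2 gives [0,1/2] at internal vertices, and with k = 0 gives [1,2] at
leaves. If degree 2 is allowed, repeating k = 0 reaches all of [0,∞). -/

open SimpleGraph


/-! ### Connected vertex sets under maps -/

/-- A map that sends adjacent vertices to equal or adjacent vertices preserves reachability. -/
lemma reachable_of_map {V W : Type*} {G : SimpleGraph V} {H : SimpleGraph W} (f : V → W)
    (hf : ∀ u v, G.Adj u v → f u = f v ∨ H.Adj (f u) (f v)) {u v : V} (h : G.Reachable u v) :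
    H.Reachable (f u) (f v) := by
  obtain ⟨p⟩ := h
  induction p with
  | nil => exact Reachable.rfl
  | cons h p ih =>
    rcases hf _ _ h with h | h
    · rwa [h]
    · exact h.reachable.trans ih

/-- A map that sends adjacent vertices of `s` to equal or adjacent vertices preserves connectedness
of induced subgraphs. -/
lemma connected_induce_of_image {V W : Type*} {G : SimpleGraph V} {H : SimpleGraph W} {s : Set V}
    {t : Set W} (f : V → W) (hst : f '' s = t)
    (hf : ∀ u ∈ s, ∀ v ∈ s, G.Adj u v → f u = f v ∨ H.Adj (f u) (f v))
    (hs : (G.induce s).Connected) : (H.induce t).Connected := by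
  subst hst
  have hmem : ∀ u : s, f u ∈ f '' s := fun u => ⟨u, u.2, rfl⟩
  obtain ⟨x⟩ := hs.nonempty
  refine (connected_iff _).2 ⟨?_, ⟨⟨f x, hmem x⟩⟩⟩
  rintro ⟨_, u, hu, rfl⟩ ⟨_, v, hv, rfl⟩
  refine reachable_of_map (fun u : s => (⟨f u, hmem u⟩ : (f '' s : Set W))) ?_
    (hs.preconnected ⟨u, hu⟩ ⟨v, hv⟩)
  intro u v h
  exact (hf u u.2 v v.2 h).imp Subtype.ext id

/-- A function that is constant along the edges of a connected induced subgraph is constant. -/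
lemma eq_of_connected_induce {V W : Type*} {G : SimpleGraph V} {s : Set V} (f : V → W)
    (hf : ∀ u ∈ s, ∀ v ∈ s, G.Adj u v → f u = f v) (hs : (G.induce s).Connected) {u v : V}
    (hu : u ∈ s) (hv : v ∈ s) : f u = f v :=
  reachable_bot.1 <| reachable_of_map (fun u : s => f u)
    (fun u v h => Or.inl (hf u u.2 v v.2 h)) (hs.preconnected ⟨u, hu⟩ ⟨v, hv⟩)

/-! ### Joining two rooted graphs by an edge -/

/-- The graph obtained from the disjoint union of `G` and `H` by adding an edge from `r` to `s`. -/
def graft {V W : Type*} (G : SimpleGraph V) (r : V) (H : SimpleGraph W) (s : W) :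
    SimpleGraph (V ⊕ W) where
  Adj x y := match x, y with
    | .inl a, .inl b => G.Adj a b
    | .inr a, .inr b => H.Adj a b
    | .inl a, .inr b => a = r ∧ b = s
    | .inr b, .inl a => a = r ∧ b = s
  symm := ⟨by
    rintro (a | a) (b | b) h
    exacts [G.adj_symm h, h, h, H.adj_symm h]⟩
  loopless := ⟨by
    rintro (a | a) h
    exacts [G.irrefl h, H.irrefl h]⟩

section graft

variable {V W : Type*} (G : SimpleGraph V) (r : V) (H : SimpleGraph W) (s : W)

@[simp] lemma graft_adj_inl_inl {a b : V} :
    (graft G r H s).Adj (.inl a) (.inl b) ↔ G.Adj a b := Iff.rfl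

@[simp] lemma graft_adj_inr_inr {a b : W} :
    (graft G r H s).Adj (.inr a) (.inr b) ↔ H.Adj a b := Iff.rfl

@[simp] lemma graft_adj_inl_inr {a : V} {b : W} :
    (graft G r H s).Adj (.inl a) (.inr b) ↔ a = r ∧ b = s := Iff.rfl

@[simp] lemma graft_adj_inr_inl {a : V} {b : W} :
    (graft G r H s).Adj (.inr b) (.inl a) ↔ a = r ∧ b = s := Iff.rfl

lemma graft_neighborSet_root :
    (graft G r H s).neighborSet (.inl r) = insert (.inr s) (Sum.inl '' G.neighborSet r) := by
  ext (x | x) <;> simp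

lemma graft_neighborSet_inl {a : V} (h : a ≠ r) :
    (graft G r H s).neighborSet (.inl a) = Sum.inl '' G.neighborSet a := by
  ext (x | x) <;> simp [h]

lemma graft_neighborSet_inr_root :
    (graft G r H s).neighborSet (.inr s) = insert (.inl r) (Sum.inr '' H.neighborSet s) := by
  ext (x | x) <;> simp

lemma graft_neighborSet_inr {b : W} (h : b ≠ s) :
    (graft G r H s).neighborSet (.inr b) = Sum.inr '' H.neighborSet b := by
  ext (x | x) <;> simp [h]

lemma connected_induce_image_inl {A : Set V} :
    ((graft G r H s).induce (Sum.inl '' A)).Connected ↔ (G.induce A).Connected := by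
  refine ⟨connected_induce_of_image (Sum.elim id fun _ => r) (by simp [Set.image_image]) ?_,
    connected_induce_of_image Sum.inl rfl fun u _ v _ h => Or.inr h⟩
  rintro _ ⟨u, hu, rfl⟩ _ ⟨v, hv, rfl⟩ h
  exact Or.inr h

lemma connected_induce_image_inr {B : Set W} :
    ((graft G r H s).induce (Sum.inr '' B)).Connected ↔ (H.induce B).Connected := by
  refine ⟨connected_induce_of_image (Sum.elim (fun _ => s) id) (by simp [Set.image_image]) ?_,
    connected_induce_of_image Sum.inr rfl fun u _ v _ h => Or.inr h⟩
  rintro _ ⟨u, hu, rfl⟩ _ ⟨v, hv, rfl⟩ h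
  exact Or.inr h

/-- A connected set of vertices of a graft that meets both sides contains the new edge. -/
lemma root_mem_of_connected_induce_graft {A : Set V} {B : Set W} (hA : A.Nonempty)
    (hB : B.Nonempty) (h : ((graft G r H s).induce (Sum.inl '' A ∪ Sum.inr '' B)).Connected) :
    r ∈ A ∧ s ∈ B := by
  by_contra hrs
  obtain ⟨a, ha⟩ := hA
  obtain ⟨b, hb⟩ := hB
  -- The new edge is the only one whose ends lie on different sides. If the set misses one of its
  -- ends, the side is constant on the set.
  have := eq_of_connected_induce (u := Sum.inl a) (v := Sum.inr b)
    (Sum.isLeft : V ⊕ W → Bool) ?_ h (by simp [ha]) (by simp [hb])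
  · simp at this
  · rintro (u | u) hu (v | v) hv huv
    · rfl
    · simp only [graft_adj_inl_inr] at huv
      obtain ⟨rfl, rfl⟩ := huv
      exact absurd (by simpa using And.intro hu hv) hrs
    · simp only [graft_adj_inr_inl] at huv
      obtain ⟨rfl, rfl⟩ := huv
      exact absurd (by simpa using And.intro hv hu) hrs
    · rfl

/-- Collapsing one side to the root of the other retracts the set onto its part there, which
preserves connectedness. Conversely, the new edge links the two parts. -/
lemma connected_induce_graft_of_mem {A : Set V} {B : Set W} (hr : r ∈ A) (hs : s ∈ B) :
    ((graft G r H s).induce (Sum.inl '' A ∪ Sum.inr '' B)).Connected ↔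
      (G.induce A).Connected ∧ (H.induce B).Connected := by
  constructor
  · intro h
    constructor
    · refine connected_induce_of_image (Sum.elim id fun _ => r) ?_ ?_ h
      · ext x
        simp only [Set.mem_image, Set.mem_union]
        constructor
        · rintro ⟨(y | y), hy, rfl⟩
          · simpa using hy
          · simpa using hr
        · exact fun hx => ⟨.inl x, by simpa using hx, rfl⟩
      · rintro (u | u) hu (v | v) hv huv <;> simp at huv <;> simp [huv]
    · refine connected_induce_of_image (Sum.elim (fun _ => s) id) ?_ ?_ h
      · ext x
        simp only [Set.mem_image, Set.mem_union]
        constructor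
        · rintro ⟨(y | y), hy, rfl⟩
          · simpa using hs
          · simpa using hy
        · exact fun hx => ⟨.inr x, by simpa using hx, rfl⟩
      · rintro (u | u) hu (v | v) hv huv <;> simp at huv <;> simp [huv]
  · rintro ⟨hA, hB⟩
    exact connected_induce_union (v := Sum.inl r) (w := Sum.inr s)
      ((connected_induce_image_inl G r H s).2 hA).preconnected
      ((connected_induce_image_inr G r H s).2 hB).preconnected
      (by simpa using hr) (by simpa using hs) (by simp)

end graft

lemma connected_induce_univ {V : Type*} {G : SimpleGraph V} :
    (G.induce Set.univ).Connected ↔ G.Connected :=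
  (induceUnivIso G).connected_iff

/-- Acyclicity is checked edge by edge, as every edge being a bridge. A walk that bypasses an old
edge would, after collapsing the other side to a root, bypass it in its own tree; the new edge is
the only link between the sides. -/
lemma isTree_graft {V W : Type*} {G : SimpleGraph V} {H : SimpleGraph W} (hG : G.IsTree)
    (hH : H.IsTree) (r : V) (s : W) : (graft G r H s).IsTree := by
  refine ⟨?_, ?_⟩
  · have := (connected_induce_graft_of_mem G r H s (Set.mem_univ r) (Set.mem_univ s)).2
      ⟨connected_induce_univ.2 hG.connected, connected_induce_univ.2 hH.connected⟩
    rw [Set.image_univ, Set.image_univ, Set.range_inl_union_range_inr] at this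
    exact connected_induce_univ.1 this
  · rw [isAcyclic_iff_forall_adj_isBridge]
    have hGb := isAcyclic_iff_forall_adj_isBridge.1 hG.isAcyclic
    have hHb := isAcyclic_iff_forall_adj_isBridge.1 hH.isAcyclic
    have cross : (graft G r H s).IsBridge s(.inl r, .inr s) := by
      rw [isBridge_iff]
      intro h
      have := reachable_of_map (H := (⊥ : SimpleGraph Bool)) Sum.isLeft ?_ h
      · simp at this
      · rintro (u | u) (v | v) huv <;> simp at huv ⊢ <;> tauto
    rintro (u | u) (v | v) huv
    · rw [isBridge_iff]
      refine fun h => isBridge_iff.1 (hGb huv) (reachable_of_map (Sum.elim id fun _ => r) ?_ h)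
      rintro (x | x) (y | y) hxy <;> simp at hxy ⊢ <;> tauto
    · obtain ⟨rfl, rfl⟩ := huv
      exact cross
    · obtain ⟨rfl, rfl⟩ := huv
      rw [Sym2.eq_swap]
      exact cross
    · rw [isBridge_iff]
      refine fun h => isBridge_iff.1 (hHb huv) (reachable_of_map (Sum.elim (fun _ => s) id) ?_ h)
      rintro (x | x) (y | y) hxy <;> simp at hxy ⊢ <;> tauto

/-! ### Subtrees as connected vertex sets -/

/-- The number of connected vertex sets that contain `v`. -/
noncomputable def countOn {V : Type*} (G : SimpleGraph V) (v : V) : ℕ :=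
  {A : Set V | (G.induce A).Connected ∧ v ∈ A}.ncard

/-- The number of connected vertex sets that do not contain `v`. -/
noncomputable def countOff {V : Type*} (G : SimpleGraph V) (v : V) : ℕ :=
  {A : Set V | (G.induce A).Connected ∧ v ∉ A}.ncard

/-- A subtree of an acyclic graph is an induced subgraph: for adjacent u, v in it, its own path from
u to v must be the unique path of `T`, the single edge uv. -/
lemma verts_injOn_subtrees {V : Type*} {T : SimpleGraph V} (hT : T.IsAcyclic) :
    Set.InjOn Subgraph.verts (subtrees T) := by
  have key : ∀ S ∈ subtrees T, ∀ u ∈ S.verts, ∀ v ∈ S.verts, T.Adj u v → S.Adj u v := by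
    intro S hS u hu v hv huv
    have hS : S.coe.IsTree := hS
    obtain ⟨p, hp⟩ := hS.connected.exists_isPath ⟨u, hu⟩ ⟨v, hv⟩
    have h1 : (p.map S.hom).IsPath := hp.map S.hom_injective
    have h2 := (hT.subsingleton_path u v).elim ⟨_, h1⟩ (Path.singleton huv)
    have h3 : (p.map S.hom).length = 1 := by
      have := congrArg (fun q : T.Path u v => q.1.length) h2
      exact this
    rw [Walk.length_map] at h3
    exact Walk.adj_of_length_eq_one h3
  intro S hS S' hS' h
  refine Subgraph.ext h ?_
  ext u v
  exact ⟨fun huv => key S' hS' u (h ▸ huv.fst_mem) v (h ▸ huv.snd_mem) huv.adj_sub,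
    fun huv => key S hS u (h ▸ huv.fst_mem) v (h ▸ huv.snd_mem) huv.adj_sub⟩

lemma verts_image_subtrees {V : Type*} {T : SimpleGraph V} (hT : T.IsAcyclic) :
    Subgraph.verts '' subtrees T = {A : Set V | (T.induce A).Connected} := by
  ext A
  constructor
  · rintro ⟨S, hS, rfl⟩
    have hS : S.coe.IsTree := hS
    exact Subgraph.Connected.induce_verts (Subgraph.connected_iff'.2 hS.connected)
  · intro hA
    refine ⟨(⊤ : T.Subgraph).induce A, ?_, rfl⟩
    show ((⊤ : T.Subgraph).induce A).coe.IsTree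
    rw [← induce_eq_coe_induce_top]
    exact ⟨hA, hT.induce A⟩

lemma subtreeProb_eq {V : Type*} [Finite V] {T : SimpleGraph V} (hT : T.IsTree) (v : V) :
    subtreeProb T v = countOn T v / (countOn T v + countOff T v : ℝ) := by
  have h1 : (subtreesAt T v).ncard = countOn T v := by
    rw [countOn, ← Set.InjOn.ncard_image ((verts_injOn_subtrees hT.isAcyclic).mono
      (fun S hS => hS.1 : subtreesAt T v ⊆ subtrees T))]
    congr 1
    ext A
    have := Set.ext_iff.1 (verts_image_subtrees hT.isAcyclic) A
    simp only [Set.mem_image, Set.mem_ofPred_eq] at this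
    simp only [Set.mem_image, Set.mem_ofPred_eq, ← this, subtreesAt]
    constructor
    · rintro ⟨S, hS, rfl⟩
      exact ⟨⟨S, hS.1, rfl⟩, hS.2⟩
    · rintro ⟨⟨S, hS, rfl⟩, h⟩
      exact ⟨S, ⟨hS, h⟩, rfl⟩
  have h2 : (subtrees T).ncard = countOn T v + countOff T v := by
    rw [countOn, countOff, ← Set.InjOn.ncard_image (verts_injOn_subtrees hT.isAcyclic),
      verts_image_subtrees hT.isAcyclic, ← Set.ncard_union_eq]
    · congr 1
      ext A
      by_cases h : v ∈ A <;> simp [h]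
    · exact Set.disjoint_left.2 fun A h h' => h'.2 h.2
  rw [subtreeProb, h1, h2]
  push_cast
  rfl

/-! ### Recursion for the counts -/

section graft

variable {V W : Type*} (G : SimpleGraph V) (r : V) (H : SimpleGraph W) (s : W)

lemma image_union_injective :
    Function.Injective fun p : Set V × Set W => Sum.inl '' p.1 ∪ Sum.inr '' p.2 :=
  Set.sumEquiv.symm.injective

lemma exists_eq_image_union (A : Set (V ⊕ W)) :
    ∃ (B : Set V) (C : Set W), A = Sum.inl '' B ∪ Sum.inr '' C := by
  obtain ⟨⟨B, C⟩, h⟩ := Set.sumEquiv.symm.surjective A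
  exact ⟨B, C, h.symm⟩

/-- A connected set through `r` is a connected set through `r` in `G` together with either nothing
in `H`, whence the summand 1, or a connected set through `s`. -/
lemma countOn_graft [Finite V] [Finite W] :
    countOn (graft G r H s) (.inl r) = countOn G r * (1 + countOn H s) := by
  have h1 : (insert ∅ {B : Set W | (H.induce B).Connected ∧ s ∈ B}).ncard = 1 + countOn H s := by
    rw [Set.ncard_insert_of_notMem (by simp), countOn, add_comm]
  rw [← h1, countOn, countOn, ← Set.ncard_prod,
    ← Set.ncard_image_of_injective _ image_union_injective]
  congr 1
  ext A
  obtain ⟨B, C, rfl⟩ := exists_eq_image_union A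
  have : Sum.inl '' B ∪ Sum.inr '' C = (fun p : Set V × Set W => Sum.inl '' p.1 ∪ Sum.inr '' p.2)
    (B, C) := rfl
  rw [this, image_union_injective.mem_set_image]
  simp only [Set.mem_ofPred_eq, Set.mem_prod, Set.mem_insert_iff, Set.mem_union, Set.mem_image,
    Sum.inl.injEq, exists_eq_right, reduceCtorEq, and_false, exists_false, or_false]
  constructor
  · rintro ⟨h, hr⟩
    rcases C.eq_empty_or_nonempty with rfl | hC
    · rw [Set.image_empty, Set.union_empty, connected_induce_image_inl] at h
      exact ⟨⟨h, hr⟩, Or.inl rfl⟩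
    · have hs := (root_mem_of_connected_induce_graft G r H s ⟨r, hr⟩ hC h).2
      rw [connected_induce_graft_of_mem G r H s hr hs] at h
      exact ⟨⟨h.1, hr⟩, Or.inr ⟨h.2, hs⟩⟩
  · rintro ⟨⟨h, hr⟩, rfl | ⟨h', hs⟩⟩
    · rw [Set.image_empty, Set.union_empty, connected_induce_image_inl]
      exact ⟨h, hr⟩
    · exact ⟨(connected_induce_graft_of_mem G r H s hr hs).2 ⟨h, h'⟩, hr⟩

/-- A connected set avoiding `r` cannot use the new edge, so it lies on one side; on the side of `H`
it is arbitrary. -/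
lemma countOff_graft [Finite V] [Finite W] :
    countOff (graft G r H s) (.inl r) = countOff G r + (countOn H s + countOff H s) := by
  have h1 : {B : Set W | (H.induce B).Connected}.ncard = countOn H s + countOff H s := by
    rw [countOn, countOff, ← Set.ncard_union_eq]
    · congr 1
      ext A
      by_cases h : s ∈ A <;> simp [h]
    · exact Set.disjoint_left.2 fun A h h' => h'.2 h.2
  rw [← h1, countOff, countOff,
    ← Set.ncard_image_of_injective {A | (G.induce A).Connected ∧ r ∉ A}
      (Set.image_injective.2 (Sum.inl_injective (β := W))),
    ← Set.ncard_image_of_injective {B | (H.induce B).Connected}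
      (Set.image_injective.2 (Sum.inr_injective (α := V))),
    ← Set.ncard_union_eq]
  · congr 1
    ext A
    obtain ⟨B, C, rfl⟩ := exists_eq_image_union A
    constructor
    · rintro ⟨h, hr⟩
      rcases C.eq_empty_or_nonempty with rfl | hC
      · rw [Set.image_empty, Set.union_empty] at h hr ⊢
        rw [connected_induce_image_inl] at h
        exact Or.inl ⟨B, ⟨h, by simpa using hr⟩, rfl⟩
      · rcases B.eq_empty_or_nonempty with rfl | hB
        · rw [Set.image_empty, Set.empty_union] at h ⊢
          rw [connected_induce_image_inr] at h
          exact Or.inr ⟨C, h, rfl⟩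
        · have := (root_mem_of_connected_induce_graft G r H s hB hC h).1
          simp [this] at hr
    · rintro (⟨B', ⟨h, hr⟩, h'⟩ | ⟨C', h, h'⟩)
      · rw [← h']
        exact ⟨(connected_induce_image_inl G r H s).2 h, by simpa using hr⟩
      · rw [← h']
        exact ⟨(connected_induce_image_inr G r H s).2 h, by simp⟩
  · rw [Set.disjoint_left]
    rintro _ ⟨B, ⟨h, -⟩, rfl⟩ ⟨C, h', h2⟩
    obtain ⟨⟨b, hb⟩⟩ := h.nonempty
    have : Sum.inl b ∈ (Sum.inr '' C : Set (V ⊕ W)) := h2 ▸ Set.mem_image_of_mem _ hb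
    simp at this

end graft

/-! ### Base case, isomorphism invariance and induction on rooted trees -/

lemma countOn_of_subsingleton {V : Type*} [Subsingleton V] (G : SimpleGraph V) (v : V) :
    countOn G v = 1 := by
  rw [countOn, Set.ncard_eq_one]
  refine ⟨Set.univ, Set.ext fun A => ?_⟩
  simp only [Set.mem_ofPred_eq, Set.mem_singleton_iff]
  constructor
  · exact fun h => Set.eq_univ_of_forall fun x => Subsingleton.elim v x ▸ h.2
  · rintro rfl
    have : Nonempty V := ⟨v⟩
    exact ⟨connected_induce_univ.2 Connected.of_subsingleton, Set.mem_univ v⟩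

lemma countOff_of_subsingleton {V : Type*} [Subsingleton V] (G : SimpleGraph V) (v : V) :
    countOff G v = 0 := by
  rw [countOff]
  convert Set.ncard_empty (Set V)
  refine Set.eq_empty_of_forall_notMem fun A h => ?_
  obtain ⟨⟨x, hx⟩⟩ := h.1.nonempty
  exact h.2 (Subsingleton.elim x v ▸ hx)

lemma SimpleGraph.Iso.connected_induce_image {V W : Type*} {G : SimpleGraph V} {H : SimpleGraph W}
    (e : G ≃g H) (A : Set V) : (H.induce (e '' A)).Connected ↔ (G.induce A).Connected :=
  ⟨connected_induce_of_image e.symm (by simp [Set.image_image])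
    fun _ _ _ _ h => Or.inr (e.symm.map_adj_iff.2 h),
    connected_induce_of_image e rfl fun _ _ _ _ h => Or.inr (e.map_adj_iff.2 h)⟩

lemma SimpleGraph.Iso.countOn_eq {V W : Type*} {G : SimpleGraph V} {H : SimpleGraph W}
    (e : G ≃g H) (v : V) : countOn H (e v) = countOn G v := by
  rw [countOn, countOn, ← Set.ncard_image_of_injective _ (Set.image_injective.2 e.injective)]
  congr 1
  ext A
  obtain ⟨B, rfl⟩ := e.surjective.image_surjective A
  rw [(Set.image_injective.2 e.injective).mem_set_image]
  simp only [Set.mem_ofPred_eq, e.connected_induce_image, e.injective.mem_set_image]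

lemma SimpleGraph.Iso.countOff_eq {V W : Type*} {G : SimpleGraph V} {H : SimpleGraph W}
    (e : G ≃g H) (v : V) : countOff H (e v) = countOff G v := by
  rw [countOff, countOff, ← Set.ncard_image_of_injective _ (Set.image_injective.2 e.injective)]
  congr 1
  ext A
  obtain ⟨B, rfl⟩ := e.surjective.image_surjective A
  rw [(Set.image_injective.2 e.injective).mem_set_image]
  simp only [Set.mem_ofPred_eq, e.connected_induce_image, e.injective.mem_set_image]

lemma SimpleGraph.Iso.ncard_neighborSet {V W : Type*} {G : SimpleGraph V} {H : SimpleGraph W}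
    (e : G ≃g H) (v : V) : (H.neighborSet (e v)).ncard = (G.neighborSet v).ncard := by
  rw [← Set.ncard_image_of_injective _ e.injective]
  congr 1
  ext w
  obtain ⟨u, rfl⟩ := e.surjective w
  rw [e.injective.mem_set_image]
  exact e.map_adj_iff

/-- Every finite tree with at least two vertices is a graft of two trees. -/
lemma exists_iso_graft {V : Type*} {T : SimpleGraph V} (hT : T.IsTree) {v w : V}
    (hvw : T.Adj v w) : ∃ (A : Set V) (hv : v ∈ A) (hw : w ∈ Aᶜ), (T.induce A).IsTree ∧
      (T.induce Aᶜ).IsTree ∧ ∃ e : graft (T.induce A) ⟨v, hv⟩ (T.induce Aᶜ) ⟨w, hw⟩ ≃g T,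
        e (.inl ⟨v, hv⟩) = v := by
  classical
  have hb := isBridge_iff.1 (isAcyclic_iff_forall_adj_isBridge.1 hT.isAcyclic hvw)
  -- Deleting the bridge vw leaves two components, that of v and that of w; they serve as A and its
  -- complement.
  set T' := T.deleteEdges {s(v, w)} with hT'
  have hle : T' ≤ T := deleteEdges_le _
  have hadj : ∀ {x y}, T.Adj x y → ¬ T'.Adj x y → x = v ∧ y = w ∨ x = w ∧ y = v := by
    intro x y h h'
    by_contra hne
    exact h' (by simpa [hT', deleteEdges_adj, h] using hne)
  have hreach : ∀ x, T'.Reachable x v ∨ T'.Reachable x w := by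
    intro x
    obtain ⟨p⟩ := hT.connected.preconnected x v
    induction p with
    | nil => exact Or.inl Reachable.rfl
    | @cons x y z h p ih =>
      by_cases h' : T'.Adj x y
      · exact (ih hvw hb hT' hle hadj).imp h'.reachable.trans h'.reachable.trans
      · rcases hadj h h' with ⟨rfl, -⟩ | ⟨rfl, -⟩
        · exact Or.inl Reachable.rfl
        · exact Or.inr Reachable.rfl
  have hconn : ∀ u, (T.induce {x | T'.Reachable x u}).Connected := by
    intro u
    have h := (T'.connectedComponentMk u).connected_toSimpleGraph
    refine Connected.mono (G := T'.induce {x | T'.Reachable x u}) (fun x y h => hle h) ?_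
    have : {x | T'.Reachable x u} = (T'.connectedComponentMk u).supp := by
      ext x
      simp [ConnectedComponent.mem_supp_iff]
    rw [this]
    exact h
  have hcompl : {x | T'.Reachable x v}ᶜ = {x | T'.Reachable x w} := by
    ext x
    simp only [Set.mem_compl_iff, Set.mem_ofPred_eq]
    exact ⟨(hreach x).resolve_left, fun h h' => hb (h'.symm.trans h)⟩
  refine ⟨{x | T'.Reachable x v}, Reachable.rfl, by rw [hcompl]; exact Reachable.rfl,
    ⟨hconn v, hT.isAcyclic.induce _⟩, ⟨by rw [hcompl]; exact hconn w, hT.isAcyclic.induce _⟩,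
    ⟨Equiv.Set.sumCompl _, ?_⟩, rfl⟩
  have hcross : ∀ x y, T'.Reachable x v → ¬ T'.Reachable y v → (T.Adj x y ↔ x = v ∧ y = w) := by
    intro x y hx hy
    constructor
    · intro h
      have h' : ¬ T'.Adj x y := fun h' => hy (h'.symm.reachable.trans hx)
      rcases hadj h h' with h | ⟨-, rfl⟩
      · exact h
      · exact absurd Reachable.rfl hy
    · rintro ⟨rfl, rfl⟩
      exact hvw
  rintro (⟨x, hx⟩ | ⟨x, hx⟩) (⟨y, hy⟩ | ⟨y, hy⟩)
  · simp
  · simpa [Subtype.ext_iff] using hcross x y hx hy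
  · simpa [Subtype.ext_iff, T.adj_comm x y] using hcross y x hy hx
  · simp

/-- Induction on rooted trees: a property of rooted trees that is invariant under isomorphism, true
for a single vertex, and preserved by grafting holds for all finite rooted trees. -/
theorem isTree_induction {P : ∀ {V : Type*}, SimpleGraph V → V → Prop}
    (iso : ∀ {V W : Type _} {G : SimpleGraph V} {H : SimpleGraph W} (e : G ≃g H) (v : V),
      P G v → P H (e v))
    (subsingleton : ∀ {V : Type _} [Subsingleton V] (G : SimpleGraph V) (v : V), P G v)
    (graft : ∀ {V W : Type _} [Finite V] [Finite W] {G : SimpleGraph V} {H : SimpleGraph W}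
      (r : V) (s : W), G.IsTree → H.IsTree → P G r → P H s → P (graft G r H s) (.inl r))
    {V : Type _} [Finite V] {T : SimpleGraph V} (hT : T.IsTree) (v : V) : P T v := by
  induction h : Nat.card V using Nat.strong_induction_on generalizing V with
  | _ n ih =>
    rcases subsingleton_or_nontrivial V with hV | hV
    · exact subsingleton T v
    · obtain ⟨w, hw⟩ := hT.connected.preconnected.exists_adj_of_nontrivial v
      obtain ⟨A, hv, hw, hA, hA', e, he⟩ := exists_iso_graft hT hw
      rw [← he]
      refine iso e _ (graft _ _ hA hA' (ih _ ?_ hA _ rfl) (ih _ ?_ hA' _ rfl)) <;>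
      · rw [← h, ← Nat.card_congr e.toEquiv, Nat.card_sum]
        have : 0 < Nat.card A := Nat.card_pos_iff.2 ⟨⟨⟨v, hv⟩⟩, inferInstance⟩
        have : 0 < Nat.card (Aᶜ : Set V) := Nat.card_pos_iff.2 ⟨⟨⟨w, hw⟩⟩, inferInstance⟩
        omega

/-! ### Degrees in a graft -/

section graft

variable {V W : Type*} (G : SimpleGraph V) (r : V) (H : SimpleGraph W) (s : W)

lemma ncard_neighborSet_graft_root [Finite V] :
    ((graft G r H s).neighborSet (.inl r)).ncard = (G.neighborSet r).ncard + 1 := by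
  rw [graft_neighborSet_root, Set.ncard_insert_of_notMem (by simp),
    Set.ncard_image_of_injective _ Sum.inl_injective]

lemma ncard_neighborSet_graft_inr_root [Finite W] :
    ((graft G r H s).neighborSet (.inr s)).ncard = (H.neighborSet s).ncard + 1 := by
  rw [graft_neighborSet_inr_root, Set.ncard_insert_of_notMem (by simp),
    Set.ncard_image_of_injective _ Sum.inr_injective]

lemma ncard_neighborSet_graft_inl {a : V} (h : a ≠ r) :
    ((graft G r H s).neighborSet (.inl a)).ncard = (G.neighborSet a).ncard := by
  rw [graft_neighborSet_inl _ _ _ _ h, Set.ncard_image_of_injective _ Sum.inl_injective]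

lemma ncard_neighborSet_graft_inr {b : W} (h : b ≠ s) :
    ((graft G r H s).neighborSet (.inr b)).ncard = (H.neighborSet b).ncard := by
  rw [graft_neighborSet_inr _ _ _ _ h, Set.ncard_image_of_injective _ Sum.inr_injective]

/-- In a graft the vertices other than the root have degree different from 2 if and only if this
holds in both parts and the second root does not have degree 1 in its part. -/
lemma forall_ncard_neighborSet_graft_ne_two [Finite W] :
    (∀ x ≠ .inl r, ((graft G r H s).neighborSet x).ncard ≠ 2) ↔
      (∀ a ≠ r, (G.neighborSet a).ncard ≠ 2) ∧ (∀ b ≠ s, (H.neighborSet b).ncard ≠ 2) ∧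
        (H.neighborSet s).ncard ≠ 1 := by
  constructor
  · intro h
    refine ⟨fun a ha => ?_, fun b hb => ?_, ?_⟩
    · rw [← ncard_neighborSet_graft_inl G r H s ha]
      exact h _ (by simpa using ha)
    · rw [← ncard_neighborSet_graft_inr G r H s hb]
      exact h _ (by simp)
    · have := h (.inr s) (by simp)
      rw [ncard_neighborSet_graft_inr_root] at this
      omega
  · rintro ⟨h1, h2, h3⟩ (a | b) hx
    · have ha : a ≠ r := by simpa using hx
      rw [ncard_neighborSet_graft_inl G r H s ha]
      exact h1 a ha
    · by_cases hb : b = s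
      · rw [hb, ncard_neighborSet_graft_inr_root]
        omega
      · rw [ncard_neighborSet_graft_inr G r H s hb]
        exact h2 b hb

end graft

/-! ### Bounds for series-reduced trees -/

/-- Relations between the order `c` of a rooted tree, the degree `d` of its root, and the numbers
`a` and `b` of subtrees that contain, respectively avoid, the root. -/
structure RootedBounds (c d a b : ℕ) : Prop where
  one_le : 1 ≤ a
  two_le : 1 ≤ d → 2 ≤ a
  four_le : 2 ≤ d → 4 ≤ a
  card_le : c ≤ b + 1
  of_zero : d = 0 → a = 1 ∧ b = 0 ∧ c = 1
  of_one : d = 1 → b + 3 ≤ 2 * a ∧ a + c ≤ b + 3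
  of_two : d = 2 → b + 1 ≤ a
  of_three : 3 ≤ d → 2 * b ≤ a

/-- The root of the branch gains an edge, so degree 1 is excluded for it. Each bound then follows
from the bound for the previous root degree and b' + 1 ≤ a'. -/
lemma RootedBounds.graft {c d a b c' d' a' b' : ℕ} (h : RootedBounds c d a b)
    (h' : RootedBounds c' d' a' b') (hd' : d' ≠ 1) :
    RootedBounds (c + c') (d + 1) (a * (1 + a')) (b + (a' + b')) := by
  have ha := h.one_le
  have ha' := h'.one_le
  have hb' : b' + 1 ≤ a' := by
    rcases Nat.lt_or_ge d' 3 with hd | hd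
    · interval_cases d'
      · have := (h'.of_zero rfl).2.1
        omega
      · exact absurd rfl hd'
      · exact h'.of_two rfl
    · have := h'.of_three hd
      omega
  have hcard := h.card_le
  have hcard' := h'.card_le
  refine ⟨by nlinarith, fun _ => by nlinarith, fun hd => ?_, by omega, by omega, fun hd => ?_,
    fun hd => ?_, fun hd => ?_⟩
  · have := h.two_le (by omega)
    nlinarith
  · obtain ⟨rfl, rfl, rfl⟩ := h.of_zero (by omega)
    omega
  · have h2 := h.two_le (by omega)
    have h3 := (h.of_one (by omega)).1
    -- With a = 2 + x and a' = 1 + y, the slack left after inserting the bounds on b and b' is xy +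
    -- 1.
    obtain ⟨x, rfl⟩ := Nat.exists_eq_add_of_le h2
    obtain ⟨y, rfl⟩ := Nat.exists_eq_add_of_le ha'
    nlinarith [Nat.zero_le (x * y)]
  · have h4 := h.four_le (by omega)
    -- With a = 4 + x and a' = 1 + y, the slack for d = 2 is xy.
    obtain ⟨x, rfl⟩ := Nat.exists_eq_add_of_le h4
    obtain ⟨y, rfl⟩ := Nat.exists_eq_add_of_le ha'
    rcases (show d = 2 ∨ 3 ≤ d by omega) with hd | hd
    · have h5 := h.of_two hd
      nlinarith [Nat.zero_le (x * y)]
    · have h5 := h.of_three hd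
      nlinarith [Nat.zero_le (x * y)]

lemma rootedBounds {V : Type*} [Finite V] {T : SimpleGraph V} (hT : T.IsTree) (v : V)
    (h2 : ∀ u ≠ v, (T.neighborSet u).ncard ≠ 2) :
    RootedBounds (Nat.card V) (T.neighborSet v).ncard (countOn T v) (countOff T v) := by
  revert h2
  refine isTree_induction (P := fun {V} T v => (∀ u ≠ v, (T.neighborSet u).ncard ≠ 2) →
    RootedBounds (Nat.card V) (T.neighborSet v).ncard (countOn T v) (countOff T v)) ?_ ?_ ?_ hT v
  · intro V W G H e v h h2
    rw [← Nat.card_congr e.toEquiv, e.ncard_neighborSet, e.countOn_eq, e.countOff_eq]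
    refine h fun u hu => ?_
    rw [← e.ncard_neighborSet]
    exact h2 _ (e.injective.ne hu)
  · intro V _ G v _
    have h0 : G.neighborSet v = ∅ := Set.eq_empty_of_forall_notMem fun w hw =>
      G.ne_of_adj hw (Subsingleton.elim _ _)
    have : Nonempty V := ⟨v⟩
    rw [h0, Set.ncard_empty, countOn_of_subsingleton, countOff_of_subsingleton, Nat.card_unique]
    constructor <;> simp
  · intro V W _ _ G H r s hG hH h h' h2
    rw [forall_ncard_neighborSet_graft_ne_two] at h2
    rw [Nat.card_sum, ncard_neighborSet_graft_root, countOn_graft, countOff_graft]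
    exact (h h2.1).graft (h' h2.2.1) h2.2.2

theorem subtreeProb_mem_Icc {V : Type*} [Finite V] {T : SimpleGraph V} (hT : T.IsTree)
    (hs : IsSeriesReduced T) (hV : 2 < Nat.card V) (v : V) :
    (IsLeafOf T v → subtreeProb T v ∈ Set.Icc (1 / 3 : ℝ) (1 / 2)) ∧
      (¬ IsLeafOf T v → subtreeProb T v ∈ Set.Icc (2 / 3 : ℝ) 1) := by
  have h := rootedBounds hT v fun u _ => hs u
  have hpos : (0 : ℝ) < countOn T v + countOff T v := by
    have : (1 : ℝ) ≤ countOn T v := by exact_mod_cast h.one_le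
    positivity
  rw [subtreeProb_eq hT, Set.mem_Icc, Set.mem_Icc, le_div_iff₀ hpos, le_div_iff₀ hpos,
    div_le_iff₀ hpos, div_le_iff₀ hpos]
  constructor
  · intro hv
    obtain ⟨h1, h2⟩ := h.of_one hv
    have h1' : (countOff T v + 3 : ℝ) ≤ 2 * countOn T v := by exact_mod_cast h1
    have h2' : (countOn T v : ℝ) ≤ countOff T v := by
      -- Order at least 3 turns a + c ≤ b + 3 into a ≤ b.
      have : countOn T v ≤ countOff T v := by omega
      exact_mod_cast this
    constructor <;> linarith
  · intro hv
    have hd : 3 ≤ (T.neighborSet v).ncard := by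
      have h0 := fun h0 => (h.of_zero h0).2.2
      have h1 : (T.neighborSet v).ncard ≠ 1 := hv
      have h2 := hs v
      omega
    have h3 : (2 * countOff T v : ℝ) ≤ countOn T v := by exact_mod_cast h.of_three hd
    constructor <;> linarith [(countOff T v).cast_nonneg (α := ℝ)]

/-! ### Approximating ratios b/a -/

/-- There is a rooted tree of order `c` whose root has degree `d`, with `a` subtrees that contain
the root and `b` that do not; if `s` holds, no vertex other than the root has degree 2. -/
def Realizes (s : Prop) (c d a b : ℕ) : Prop :=
  ∃ (V : Type) (_ : Finite V) (T : SimpleGraph V) (v : V), T.IsTree ∧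
    (s → ∀ u ≠ v, (T.neighborSet u).ncard ≠ 2) ∧ Nat.card V = c ∧
    (T.neighborSet v).ncard = d ∧ countOn T v = a ∧ countOff T v = b

lemma realizes_point (s : Prop) : Realizes s 1 0 1 0 := by
  refine ⟨Unit, inferInstance, ⊥, (), IsTree.of_subsingleton,
    fun _ u hu => absurd (Subsingleton.elim _ _) hu, by simp, by simp [neighborSet],
    countOn_of_subsingleton _ _, countOff_of_subsingleton _ _⟩

lemma Realizes.graft {s : Prop} {c d a b c' d' a' b' : ℕ} (h : Realizes s c d a b)
    (h' : Realizes s c' d' a' b') (hd : s → d' ≠ 1) :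
    Realizes s (c + c') (d + 1) (a * (1 + a')) (b + (a' + b')) := by
  obtain ⟨V, _, G, r, hG, h2, rfl, rfl, rfl, rfl⟩ := h
  obtain ⟨W, _, H, t, hH, h2', rfl, rfl, rfl, rfl⟩ := h'
  exact ⟨V ⊕ W, inferInstance, _root_.graft G r H t, .inl r, isTree_graft hG hH r t,
    fun hs => (forall_ncard_neighborSet_graft_ne_two G r H t).2 ⟨h2 hs, h2' hs, hd hs⟩,
    Nat.card_sum, ncard_neighborSet_graft_root G r H t, countOn_graft G r H t,
    countOff_graft G r H t⟩

/-- Attaching `k` leaves to the root. -/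
lemma Realizes.add_leaves {s : Prop} {c d a b : ℕ} (h : Realizes s c d a b) (k : ℕ) :
    Realizes s (c + k) (d + k) (2 ^ k * a) (b + k) := by
  induction k with
  | zero => simpa using h
  | succ k ih =>
    have := ih.graft (realizes_point s) (by simp)
    convert this using 1 <;> ring

/-- A new root with `k` leaves and the given rooted tree as branches. -/
lemma Realizes.extend {s : Prop} {c d a b : ℕ} (h : Realizes s c d a b) (hd : s → d ≠ 1) (k : ℕ) :
    Realizes s (c + 1 + k) (k + 1) (2 ^ k * (1 + a)) (a + b + k) := by
  convert ((realizes_point s).graft h hd).add_leaves k using 1 <;> ring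

/-- The number `x` is approximated by the quotients `b / a` of rooted trees with more than two
vertices, arbitrarily large `a`, and root degree in `D`. -/
def Approx (s : Prop) (D : Set ℕ) (x : ℝ) : Prop :=
  ∀ ε > 0, ∀ M : ℝ, ∃ c d a b : ℕ, Realizes s c d a b ∧ 2 < c ∧ d ∈ D ∧ M ≤ a ∧ |(b / a : ℝ) - x| < ε

lemma Approx.mono {s : Prop} {D D' : Set ℕ} {x : ℝ} (h : Approx s D x) (hD : D ⊆ D') :
    Approx s D' x := by
  intro ε hε M
  obtain ⟨c, d, a, b, h, hc, hd, h'⟩ := h ε hε M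
  exact ⟨c, d, a, b, h, hc, hD hd, h'⟩

lemma approx_of_forall {s : Prop} {D : Set ℕ} {x : ℝ}
    (h : ∀ ε > 0, ∃ y, |y - x| < ε ∧ Approx s D y) : Approx s D x := by
  intro ε hε M
  obtain ⟨y, hy, hA⟩ := h (ε / 2) (by linarith)
  obtain ⟨c, d, a, b, h, hc, hd, hM, hab⟩ := hA (ε / 2) (by linarith) M
  exact ⟨c, d, a, b, h, hc, hd, hM, by linarith [abs_sub_le (b / a : ℝ) y x]⟩

/-- The exact ratio is (a + b + k)/(2^k(1 + a)), which is close to (1 + b/a)/2^k only for large a;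
this is why `Approx` asks for arbitrarily large a. -/
lemma Approx.extend {s : Prop} {D : Set ℕ} {x : ℝ} (h : Approx s D x) (hD : s → 1 ∉ D) (k : ℕ) :
    Approx s {k + 1} ((1 + x) / 2 ^ k) := by
  intro ε hε M
  -- The bound 1 keeps b/a below |x| + 1, and the last lower bound on a then makes the error (k - 1
  -- - b/a)/(1 + a) less than ε/2.
  obtain ⟨c, d, a, b, h, hc, hd, hM, hab⟩ := h (min (ε / 2) 1) (by positivity)
    (max (max M 1) (2 * (k + 2 + |x|) / ε))
  rw [max_le_iff, max_le_iff, div_le_iff₀ hε] at hM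
  obtain ⟨⟨hM, ha⟩, hM'⟩ := hM
  rw [lt_min_iff] at hab
  have h2 : (1 : ℝ) ≤ 2 ^ k := one_le_pow₀ (by norm_num)
  refine ⟨_, _, _, _, h.extend ?_ k, by omega, rfl, ?_, ?_⟩
  · rintro hs rfl
    exact hD hs hd
  · push_cast
    nlinarith
  · have ha0 : (a : ℝ) ≠ 0 := by positivity
    have e : (((a + b + k : ℕ) : ℝ) / ((2 ^ k * (1 + a) : ℕ) : ℝ)) - (1 + x) / 2 ^ k
        = ((k - 1 - b / a) / (1 + a) + (b / a - x)) / 2 ^ k := by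
      push_cast
      field_simp
      ring
    rw [e, abs_div, abs_of_pos (by positivity : (0 : ℝ) < 2 ^ k), div_lt_iff₀ (by positivity)]
    have h3 : |(k - 1 - b / a : ℝ)| < k + 2 + |x| := by
      have hx := abs_lt.1 hab.2
      have := neg_abs_le x
      have := le_abs_self x
      have : (0 : ℝ) ≤ k := k.cast_nonneg
      have : (0 : ℝ) ≤ b / a := by positivity
      rw [abs_lt]
      constructor <;> linarith
    have h4 : |(k - 1 - b / a : ℝ) / (1 + a)| < ε / 2 := by
      rw [abs_div, abs_of_pos (by positivity : (0 : ℝ) < 1 + a), div_lt_iff₀ (by positivity)]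
      nlinarith
    have h5 := abs_add_le ((k - 1 - b / a : ℝ) / (1 + a)) (b / a - x)
    nlinarith [hab.1]

/-- Stars with k leaves, rooted at the centre, have a = 2^k and b = k. -/
lemma approx_zero (s : Prop) : Approx s (Set.Ici 2) 0 := by
  intro ε hε M
  have h1 : Filter.Tendsto (fun k : ℕ => (k : ℝ) / 2 ^ k) Filter.atTop (nhds 0) := by
    simpa using tendsto_pow_const_div_const_pow_of_one_lt 1 (by norm_num : (1 : ℝ) < 2)
  have h2 : Filter.Tendsto (fun k : ℕ => (2 : ℝ) ^ k) Filter.atTop Filter.atTop :=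
    tendsto_pow_atTop_atTop_of_one_lt (by norm_num)
  obtain ⟨k, hk, hk', hk2⟩ := ((h1.eventually (gt_mem_nhds hε)).and
    ((h2.eventually_ge_atTop M).and (Filter.eventually_ge_atTop 2))).exists
  have hr := (realizes_point s).add_leaves k
  refine ⟨_, _, _, _, hr, by omega, by simpa using hk2, by simpa using hk', ?_⟩
  simp only [mul_one, zero_add, Nat.cast_pow, Nat.cast_ofNat, sub_zero]
  rwa [abs_of_nonneg (by positivity)]

/-- Every `x ∈ (0, 1]` has the form `(1 + y) / 2 ^ k` with `y ∈ [0, 1]` and `k ≥ 1`. -/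
lemma exists_eq_one_add_div_two_pow {x : ℝ} (h0 : 0 < x) (h1 : x ≤ 1) :
    ∃ (k : ℕ) (y : ℝ), 1 ≤ k ∧ 0 ≤ y ∧ y ≤ 1 ∧ x = (1 + y) / 2 ^ k := by
  -- Here 2^-(n+1) < x ≤ 2^-n, so k = n + 1 puts 2^k x in (1, 2].
  obtain ⟨n, hn, hn'⟩ := exists_nat_pow_near_of_lt_one h0 h1 (by norm_num : (0 : ℝ) < 1 / 2)
    (by norm_num)
  refine ⟨n + 1, x * 2 ^ (n + 1) - 1, by omega, ?_, ?_, by field_simp; ring⟩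
  · rw [one_div_pow, div_lt_iff₀ (by positivity)] at hn
    linarith
  · rw [one_div_pow, le_div_iff₀ (by positivity)] at hn'
    rw [pow_succ]
    linarith

/-- Writing x = (1 + y)/2^k with k ≥ 1 and approximating y instead halves the error at least, so n
steps ending at 0 give precision 2^-n. The root degree k + 1 ≥ 2 keeps each tree usable as a branch.
-/
lemma approx_of_mem_Icc (s : Prop) {x : ℝ} (h0 : 0 ≤ x) (h1 : x ≤ 1) : Approx s (Set.Ici 2) x := by
  have key : ∀ n : ℕ, ∀ x : ℝ, 0 ≤ x → x ≤ 1 → ∃ y, |y - x| ≤ (1 / 2) ^ n ∧ Approx s (Set.Ici 2) y := by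
    intro n
    induction n with
    | zero =>
      intro x h0 h1
      exact ⟨0, by rw [zero_sub, abs_neg, abs_of_nonneg h0]; simpa using h1, approx_zero s⟩
    | succ n ih =>
      intro x h0 h1
      rcases h0.eq_or_lt with rfl | h0
      · exact ⟨0, by simp, approx_zero s⟩
      · obtain ⟨k, y, hk, hy0, hy1, rfl⟩ := exists_eq_one_add_div_two_pow h0 h1
        obtain ⟨z, hz, hA⟩ := ih y hy0 hy1
        refine ⟨(1 + z) / 2 ^ k, ?_, (hA.extend (by simp) k).mono (by simpa using hk)⟩
        have h2 : (2 : ℝ) ≤ 2 ^ k := by simpa using pow_le_pow_right₀ (by norm_num : (1 : ℝ) ≤ 2) hk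
        rw [← sub_div, abs_div, abs_of_pos (by positivity : (0 : ℝ) < 2 ^ k),
          div_le_iff₀ (by positivity), add_sub_add_left_eq_sub, pow_succ]
        have : (0 : ℝ) < (1 / 2) ^ n := by positivity
        nlinarith
  refine approx_of_forall fun ε hε => ?_
  obtain ⟨n, hn⟩ := exists_pow_lt_of_lt_one hε (by norm_num : (1 / 2 : ℝ) < 1)
  obtain ⟨y, hy, hA⟩ := key n x h0 h1
  exact ⟨y, hy.trans_lt hn, hA⟩

/-- Expanding 2x instead of x raises the exponent to at least 2, so the root has degree at least 3.
The value 0 is a limit of positive ones. -/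
lemma approx_three_of_mem_Icc (s : Prop) {x : ℝ} (h0 : 0 ≤ x) (h1 : x ≤ 1 / 2) :
    Approx s (Set.Ici 3) x := by
  have key : ∀ x : ℝ, 0 < x → x ≤ 1 / 2 → Approx s (Set.Ici 3) x := by
    intro x h0 h1
    obtain ⟨k, y, hk, hy0, hy1, hx⟩ := exists_eq_one_add_div_two_pow (x := 2 * x) (by linarith)
      (by linarith)
    have : x = (1 + y) / 2 ^ (k + 1) := by
      rw [pow_succ, ← div_div, ← hx]
      ring
    rw [this]
    exact ((approx_of_mem_Icc s hy0 hy1).extend (by simp) (k + 1)).mono (by simpa using hk)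
  rcases h0.eq_or_lt with rfl | h0
  · refine approx_of_forall fun ε hε => ⟨min (ε / 2) (1 / 2), ?_, key _ (by positivity)
      (min_le_right _ _)⟩
    rw [sub_zero, abs_of_pos (by positivity)]
    exact (min_le_left _ _).trans_lt (by linarith)
  · exact key x h0 h1

/-- With k = 0 the extension is x ↦ 1 + x, and it can be iterated because degree 2 is allowed. -/
lemma approx_of_nonneg {x : ℝ} (h0 : 0 ≤ x) : Approx False Set.univ x := by
  have key : ∀ n : ℕ, ∀ x : ℝ, 0 ≤ x → x ≤ n → Approx False Set.univ x := by
    intro n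
    induction n with
    | zero =>
      intro x h0 h1
      exact (approx_of_mem_Icc _ h0 (by simp at h1; linarith)).mono (Set.subset_univ _)
    | succ n ih =>
      intro x h0 h1
      rcases le_total x 1 with h | h
      · exact (approx_of_mem_Icc _ h0 h).mono (Set.subset_univ _)
      · push_cast at h1
        have := ((ih (x - 1) (by linarith) (by linarith)).extend (by simp) 0).mono
          (Set.subset_univ _)
        simpa using this
  obtain ⟨n, hn⟩ := exists_nat_ge x
  exact key n x h0 hn

/-! ### From ratios to probabilities -/

lemma subtreeProb_eq_one_div {V : Type*} [Finite V] {T : SimpleGraph V} (hT : T.IsTree) (v : V)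
    (ha : countOn T v ≠ 0) : subtreeProb T v = 1 / (1 + countOff T v / countOn T v) := by
  have : (countOn T v : ℝ) ≠ 0 := by exact_mod_cast ha
  rw [subtreeProb_eq hT]
  field_simp

lemma abs_one_div_sub_one_div_lt {x y ε : ℝ} (hx : 1 ≤ x) (hy : 1 ≤ y) (h : |x - y| < ε) :
    |1 / x - 1 / y| < ε := by
  have hx0 : 0 < x := by linarith
  have hy0 : 0 < y := by linarith
  have e : 1 / x - 1 / y = (y - x) / (x * y) := by field_simp
  rw [e, abs_div, abs_of_pos (mul_pos hx0 hy0), div_lt_iff₀ (mul_pos hx0 hy0), abs_sub_comm]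
  have : 1 ≤ x * y := by nlinarith
  nlinarith [abs_nonneg (x - y)]

lemma mem_closure_of_approx {s : Prop} {D : Set ℕ} {x : ℝ} {S : Set ℝ} (hx : 0 ≤ x)
    (hA : Approx s D x) (hS : ∀ (V : Type) [Finite V] (T : SimpleGraph V) (v : V), T.IsTree →
      (s → ∀ u ≠ v, (T.neighborSet u).ncard ≠ 2) → 2 < Nat.card V →
        (T.neighborSet v).ncard ∈ D →
          subtreeProb T v ∈ S) : 1 / (1 + x) ∈ closure S := by
  rw [Metric.mem_closure_iff]
  intro ε hε
  -- The lower bound 1 on a serves only to make the denominator nonzero.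
  obtain ⟨c, d, a, b, ⟨V, _, T, v, hT, h2, rfl, rfl, rfl, rfl⟩, hc, hd, ha, hab⟩ := hA ε hε 1
  refine ⟨_, hS V T v hT h2 hc hd, ?_⟩
  have ha' : countOn T v ≠ 0 := by
    rintro h
    rw [h] at ha
    norm_num at ha
  rw [subtreeProb_eq_one_div hT v ha', Real.dist_eq, abs_sub_comm]
  refine abs_one_div_sub_one_div_lt ?_ (by linarith) (by rwa [add_sub_add_left_eq_sub])
  have : (0 : ℝ) ≤ countOff T v / countOn T v := by positivity
  linarith

lemma treeValues_subset : treeValues ⊆ Set.Icc 0 1 := by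
  rintro _ ⟨V, _, T, v, hT, rfl⟩
  rw [subtreeProb_eq hT]
  exact ⟨by positivity, div_le_one_of_le₀ (by linarith [(countOff T v).cast_nonneg (α := ℝ)])
    (by positivity)⟩

theorem closure_treeValues : closure treeValues = Set.Icc 0 1 := by
  refine (closure_minimal treeValues_subset isClosed_Icc).antisymm ?_
  -- The value 0 corresponds to an infinite ratio and is recovered by taking the closure.
  have : Set.Ioc (0 : ℝ) 1 ⊆ closure treeValues := by
    rintro p ⟨h0, h1⟩
    have hx : 0 ≤ 1 / p - 1 := by
      rw [sub_nonneg, le_div_iff₀ h0]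
      linarith
    have := mem_closure_of_approx (S := treeValues) hx (approx_of_nonneg hx)
      fun V _ T v hT _ _ _ => ⟨V, inferInstance, T, v, hT, rfl⟩
    simpa using this
  rw [← closure_Ioc (zero_ne_one (α := ℝ))]
  exact closure_minimal this isClosed_closure

theorem closure_internalValues : closure internalValues = Set.Icc (2 / 3 : ℝ) 1 := by
  refine (closure_minimal ?_ isClosed_Icc).antisymm ?_
  · rintro _ ⟨V, _, T, v, hT, hs, hV, hv, rfl⟩
    exact (subtreeProb_mem_Icc hT hs hV v).2 hv
  · rintro p ⟨h0, h1⟩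
    have hp : 0 < p := by linarith
    have hx : 0 ≤ 1 / p - 1 := by
      rw [sub_nonneg, le_div_iff₀ hp]
      linarith
    have hx' : 1 / p - 1 ≤ 1 / 2 := by
      rw [sub_le_iff_le_add, div_le_iff₀ hp]
      linarith
    have := mem_closure_of_approx (S := internalValues) hx (approx_three_of_mem_Icc True hx hx') ?_
    · simpa using this
    · intro V _ T v hT h2 hc hd
      rw [Set.mem_Ici] at hd
      refine ⟨V, inferInstance, T, v, hT, fun u => ?_, hc, ?_, rfl⟩
      · by_cases hu : u = v
        · rw [hu]
          omega
        · exact h2 trivial u hu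
      · rw [IsLeafOf]
        omega

theorem closure_leafValues : closure leafValues = Set.Icc (1 / 3 : ℝ) (1 / 2) := by
  refine (closure_minimal ?_ isClosed_Icc).antisymm ?_
  · rintro _ ⟨V, _, T, v, hT, hs, hV, hv, rfl⟩
    exact (subtreeProb_mem_Icc hT hs hV v).1 hv
  · rintro p ⟨h0, h1⟩
    have hp : 0 < p := by linarith
    have hx : 0 ≤ 1 / p - 2 := by
      rw [sub_nonneg, le_div_iff₀ hp]
      linarith
    have hx' : 1 / p - 2 ≤ 1 := by
      rw [sub_le_iff_le_add, div_le_iff₀ hp]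
      linarith
    -- The required ratio is 1/p - 1 = 1 + x with x in [0,1]: a single edge attached to a tree of
    -- ratio near x makes the new root a leaf.
    have := mem_closure_of_approx (S := leafValues) (by positivity)
      ((approx_of_mem_Icc True hx hx').extend (by simp) 0) ?_
    · convert this using 1
      field_simp
      ring
    · intro V _ T v hT h2 hc hd
      rw [Set.mem_singleton_iff, zero_add] at hd
      refine ⟨V, inferInstance, T, v, hT, fun u => ?_, hc, hd, rfl⟩
      by_cases hu : u = v
      · rw [hu]
        omega
      · exact h2 trivial u hu

theorem mainTheorem5 :
    -- arbitrary trees: the values lie in [0,1] and are dense there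
    (treeValues ⊆ Set.Icc 0 1 ∧ closure treeValues = Set.Icc 0 1) ∧
    -- series-reduced trees with more than two vertices: the ranges
    (∀ (V : Type*) [Finite V] (T : SimpleGraph V), T.IsTree → IsSeriesReduced T →
      2 < Nat.card V → ∀ v : V,
        (IsLeafOf T v → subtreeProb T v ∈ Set.Icc (1 / 3 : ℝ) (1 / 2)) ∧
        (¬ IsLeafOf T v → subtreeProb T v ∈ Set.Icc (2 / 3 : ℝ) 1)) ∧
    -- the values are dense in the respective ranges
    closure leafValues = Set.Icc (1 / 3 : ℝ) (1 / 2) ∧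
    closure internalValues = Set.Icc (2 / 3 : ℝ) 1 :=
  ⟨⟨treeValues_subset, closure_treeValues⟩, fun _ _ _ hT hs hV v => subtreeProb_mem_Icc hT hs hV v,
    closure_leafValues, closure_internalValues⟩
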